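/- For a group $G$ let $\mathrm{C}(G)$ be its commutator subgroup and $\mathrm{Ab}(G)=G/\mathrm{C}(G)$ its abelianization. An abelian group $A$ is called cotorsion if $\mathrm{Ext}(\mathbb{Q},A)=0$, that is, every short exact sequence $0\to A\to B\to\mathbb{Q}\to 0$ of abelian groups splits. The Ulm subgroups $A^\lambda$ of an abelian group $A$ are defined for all ordinals $\lambda$ by $A^0=A$, $A^{\lambda+1}=\bigcap_{n\ge 1} nA^\lambda$, and $A^\delta=\bigcap_{\lambda<\delta}A^\lambda$ for limit ordinals $\delta$; the Ulm length of $A$ is the least ordinal $\lambda$ with $A^{\lambda+1}=A^\lambda$. Theorem. Let $(H_n)_{n\in\mathbb{N}}$ be a countable collection of groups. Then the natural map $$\rho:\mathrm{Ab}\Big(\prod_{n\in\mathbb{N}}H_n\Big)\longrightarrow\prod_{n\in\mathbb{N}}\mathrm{Ab}(H_n)$$ is surjective. Moreover $\mathrm{C}(\prod_n H_n)\subseteq\prod_n\mathrm{C}(H_n)$, the inclusion $\prod_n \mathrm{C}(H_n)\subseteq\prod_n H_n$ induces an isomorphism $$\prod_{n\in\mathbb{N}}\mathrm{C}(H_n)\Big/\mathrm{C}\Big(\prod_{n\in\mathbb{N}}H_n\Big)\;\cong\;\ker(\rho),$$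 and $\ker(\rho)$ is a cotorsion group whose Ulm length is at most $\aleph_1$ (regarded as the first uncountable ordinal). -/

import Mathlib

universe u v

/-- The natural homomorphism `Ab (∏ Hₙ) → ∏ Ab (Hₙ)`, whose `n`-th component is `Ab` of the
`n`-th projection. -/
def abProdMap (H : ℕ → Type u) [∀ n, Group (H n)] :
    Abelianization (∀ n, H n) →* ∀ n, Abelianization (H n) :=
  MonoidHom.pi fun n => Abelianization.map (Pi.evalMonoidHom H n)

/-- The product `∏ C(Hₙ)` of the commutator subgroups, as a subgroup of `∏ Hₙ`. -/
def prodCommutator (H : ℕ → Type u) [∀ n, Group (H n)] : Subgroup (∀ n, H n) :=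
  Subgroup.pi Set.univ fun n => commutator (H n)

/-- A short exact sequence `0 → A → B → C → 0` of abelian groups. Every such `B` is in bijection
with `A × C`, so the universe chosen for `B` is no restriction up to isomorphism. -/
structure AbExtension (C : Type v) (A : Type u) [AddCommGroup C] [AddCommGroup A] where
  B : Type (max u v)
  [grp : AddCommGroup B]
  inc : A →+ B
  proj : B →+ C
  inc_injective : Function.Injective inc
  proj_surjective : Function.Surjective proj
  exact : inc.range = proj.ker

attribute [instance] AbExtension.grp

namespace AbExtension

variable {C : Type v} {A : Type u} [AddCommGroup C] [AddCommGroup A]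

/-- Equivalence of extensions: an isomorphism of the middle groups that is compatible with the
identities of `A` and `C`. -/
def IsEquivalent (E F : AbExtension C A) : Prop :=
  ∃ e : E.B ≃+ F.B, (∀ a, e (E.inc a) = F.inc a) ∧ ∀ b, F.proj (e b) = E.proj b

variable (C A)

/-- The split extension `0 → A → A ⊕ C → C → 0`, the zero element of `Ext(C, A)`. -/
def split : AbExtension C A where
  B := A × C
  inc := AddMonoidHom.inl A C
  proj := AddMonoidHom.snd A C
  inc_injective := fun a b h => congrArg Prod.fst h
  proj_surjective := fun c => ⟨(0, c), rfl⟩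
  exact := by
    ext ⟨a, c⟩
    rw [AddMonoidHom.mem_range, AddMonoidHom.mem_ker]
    constructor
    · rintro ⟨x, hx⟩
      exact (congrArg Prod.snd hx).symm
    · intro h
      exact ⟨a, Prod.ext rfl (Eq.symm h)⟩

end AbExtension

/-- `A` is cotorsion if `Ext(ℚ, A) = 0`, i.e. the class of every extension of `ℚ` by `A` is the
class of the split extension. -/
def IsCotorsion (A : Type u) [AddCommGroup A] : Prop :=
  ∀ E : AbExtension ℚ A, E.IsEquivalent (AbExtension.split ℚ A)

/-- The Ulm subgroups `A^o` of an abelian group: `A^0 = A`, `A^(o+1) = ⋂_{n ≥ 1} n A^o`, and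
`A^o = ⋂_{l < o} A^l` for a limit ordinal `o`. -/
noncomputable def ulmSubgroup (A : Type u) [AddCommGroup A] (o : Ordinal.{u}) : AddSubgroup A :=
  Ordinal.limitRecOn o ⊤
    (fun _ S => ⨅ n : ℕ, ⨅ _ : 1 ≤ n, S.map (nsmulAddMonoidHom n))
    (fun o _ S => ⨅ l : Ordinal.{u}, ⨅ h : l < o, S l h)

/-- The Ulm length `u(A)`: the least ordinal `o` with `A^(o+1) = A^o`. -/
noncomputable def ulmLength (A : Type u) [AddCommGroup A] : Ordinal.{u} :=
  sInf {o : Ordinal.{u} | ulmSubgroup A (o + 1) = ulmSubgroup A o}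

theorem ulmSubgroup_add_one (A : Type u) [AddCommGroup A] (o : Ordinal.{u}) :
    ulmSubgroup A (o + 1) =
      ⨅ n : ℕ, ⨅ _ : 1 ≤ n, (ulmSubgroup A o).map (nsmulAddMonoidHom n) :=
  Ordinal.limitRecOn_add_one ..

theorem ulmSubgroup_limit (A : Type u) [AddCommGroup A] (o : Ordinal.{u})
    (ho : Order.IsSuccLimit o) :
    ulmSubgroup A o = ⨅ l : Ordinal.{u}, ⨅ _ : l < o, ulmSubgroup A l :=
  Ordinal.limitRecOn_limit _ _ _ _ ho

theorem ulmSubgroup_add_one_le (A : Type u) [AddCommGroup A] (o : Ordinal.{u}) :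
    ulmSubgroup A (o + 1) ≤ ulmSubgroup A o := by
  rw [ulmSubgroup_add_one]
  refine (iInf₂_le 1 le_rfl).trans ?_
  rintro _ ⟨x, hx, rfl⟩
  simpa using hx

theorem ulmSubgroup_antitone (A : Type u) [AddCommGroup A] : Antitone (ulmSubgroup A) := by
  intro a b hab
  induction b using Ordinal.limitRecOn with
  | zero => rw [nonpos_iff_eq_zero.mp hab]
  | add_one b ih =>
    rcases hab.eq_or_lt with rfl | h
    · exact le_rfl
    · exact (ulmSubgroup_add_one_le A b).trans (ih (Order.lt_add_one_iff.mp h))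
  | limit b hb _ =>
    rcases hab.eq_or_lt with rfl | h
    · exact le_rfl
    · rw [ulmSubgroup_limit A b hb]
      exact iInf₂_le a h

/-- The Ulm subgroups stabilize, so the infimum that defines `ulmLength` is a minimum. -/
theorem ulmLength_spec (A : Type u) [AddCommGroup A] :
    ulmSubgroup A (ulmLength A + 1) = ulmSubgroup A (ulmLength A) := by
  refine csInf_mem (s := {o : Ordinal.{u} | ulmSubgroup A (o + 1) = ulmSubgroup A o}) ?_
  by_contra hne
  rw [Set.not_nonempty_iff_eq_empty] at hne
  have hs : StrictAnti (ulmSubgroup A) := fun a b hab =>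
    (ulmSubgroup_antitone A (Order.add_one_le_of_lt hab)).trans_lt
      (lt_of_le_of_ne (ulmSubgroup_add_one_le A a) fun h => by
        have : a ∈ {o : Ordinal.{u} | ulmSubgroup A (o + 1) = ulmSubgroup A o} := h
        simp [hne] at this)
  exact not_injective_of_ordinal _ hs.injective

/-! An element of `∏ C(Hₙ)` lies in `C(∏ Hₙ)` exactly when the commutator lengths of its coordinates
are eventually bounded (`mem_commutator_pi_iff_eventually`). So `ker ρ` is a quotient of a countable
product that kills finite supports, with triviality decided by countably many coordinatewise
conditions, one per bound `k`.

Killing finite supports makes each coordinate of a system `x n = a n + (n + 1) • x (n + 1)` a finite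
recursion, which gives cotorsion. For the Ulm length, an element of the `ω₁`-th Ulm subgroup starts
finite division chains ending in `A^o` for every `o < ω₁`. As countable suprema stay below `ω₁`, one
sequence of bounds serves all of them, and a diagonal argument merges the finite chains into an
infinite one. -/

open Filter

/-! ### Cotorsion from solvable division systems. -/

section Cotorsion

/-- If every system `x n = a n + (n + 1) • x (n + 1)` is solvable in `A`, then `A` is cotorsion. -/
theorem isCotorsion_of_exists_solution {A : Type u} [AddCommGroup A]
    (hA : ∀ a : ℕ → A, ∃ x : ℕ → A, ∀ n, x n = a n + (n + 1) • x (n + 1)) : IsCotorsion A := by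
  intro E
  -- The lifts `b n` of `1 / n!` miss `b n = (n + 1) • b (n + 1)` by elements of `A`; a solution of
  -- the system corrects them.
  choose b hb using fun n : ℕ => E.proj_surjective ((n.factorial : ℚ)⁻¹)
  have hfac (n : ℕ) : (n.factorial : ℚ) ≠ 0 := by exact_mod_cast n.factorial_ne_zero
  have hker (n : ℕ) : ∃ a, E.inc a = (n + 1) • b (n + 1) - b n := by
    rw [← AddMonoidHom.mem_range, E.exact, AddMonoidHom.mem_ker, map_sub, map_nsmul, hb, hb,
      Nat.factorial_succ]
    have := hfac n
    have : (n : ℚ) + 1 ≠ 0 := by positivity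
    push_cast
    rw [nsmul_eq_mul]
    push_cast
    field_simp
    simp
  choose a ha using hker
  obtain ⟨x, hx⟩ := hA a
  have hproj (z : A) : E.proj (E.inc z) = 0 := by
    rw [← AddMonoidHom.mem_ker, ← E.exact]
    exact ⟨z, rfl⟩
  let c : ℕ → E.B := fun n => b n + E.inc (x n)
  have hc (n : ℕ) : c n = (n + 1) • c (n + 1) := by
    simp only [c]
    rw [hx n, map_add, ha, map_nsmul, smul_add]
    abel
  have hcp (n : ℕ) : E.proj (c n) = (n.factorial : ℚ)⁻¹ := by
    simp only [c, map_add, hproj, hb, add_zero]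
  have hmul (n k : ℕ) : ∃ t : ℤ, c n = t • c (n + k) := by
    induction k with
    | zero => exact ⟨1, by simp⟩
    | succ k ih =>
      obtain ⟨t, ht⟩ := ih
      refine ⟨t * ((n + k + 1 : ℕ) : ℤ), ?_⟩
      rw [ht, hc (n + k), mul_smul, natCast_zsmul]
      rfl
  -- An increasing union of cyclic groups, by `hmul`, which projects isomorphically onto `ℚ`.
  let D : AddSubgroup E.B :=
    { carrier := {y | ∃ (n : ℕ) (t : ℤ), y = t • c n}
      zero_mem' := ⟨0, 0, by simp⟩
      neg_mem' := by
        rintro _ ⟨n, t, rfl⟩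
        exact ⟨n, -t, by simp⟩
      add_mem' := by
        rintro _ _ ⟨n, t, rfl⟩ ⟨m, s, rfl⟩
        obtain ⟨p, hp⟩ := hmul n m
        obtain ⟨q, hq⟩ := hmul m n
        refine ⟨n + m, t * p + s * q, ?_⟩
        rw [hp, hq, add_comm m n, smul_smul, smul_smul, add_smul] }
  let π : D →+ ℚ := E.proj.comp D.subtype
  have hπ : Function.Bijective π := by
    constructor
    · rw [injective_iff_map_eq_zero]
      rintro ⟨_, n, t, rfl⟩ h
      have h' : (t : ℚ) * (n.factorial : ℚ)⁻¹ = 0 := by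
        simpa [π, hcp] using h
      have ht : t = 0 := by simpa [n.factorial_ne_zero] using h'
      ext
      simp [ht]
    · intro q
      refine ⟨⟨(q.num * ((q.den - 1).factorial : ℤ)) • c q.den, _, _, rfl⟩, ?_⟩
      have h1 : (q.den.factorial : ℚ) = q.den * ((q.den - 1).factorial : ℚ) := by
        rw [← Nat.cast_mul, Nat.mul_factorial_pred q.den_nz]
      have h2 := hfac (q.den - 1)
      have h3 : (q.den : ℚ) ≠ 0 := by exact_mod_cast q.den_nz
      simp only [π, AddMonoidHom.comp_apply, AddSubgroup.subtype_apply, map_zsmul, hcp, h1,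
        zsmul_eq_mul]
      push_cast
      refine Eq.trans ?_ (Rat.num_div_den q)
      field_simp
  let s : ℚ →+ E.B := D.subtype.comp (AddEquiv.ofBijective π hπ).symm.toAddMonoidHom
  have hs (q : ℚ) : E.proj (s q) = q := (AddEquiv.ofBijective π hπ).apply_symm_apply q
  let φ : A × ℚ →+ E.B := E.inc.coprod s
  have hφp (y : A × ℚ) : E.proj (φ y) = y.2 := by
    simp [φ, hproj, hs]
  have hφ : Function.Bijective φ := by
    constructor
    · rw [injective_iff_map_eq_zero]
      rintro ⟨z, q⟩ h
      have hq : q = 0 := by simpa [h] using (hφp (z, q)).symm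
      subst hq
      have hz : E.inc z = E.inc 0 := by simpa [φ] using h
      rw [E.inc_injective hz]
      rfl
    · intro y
      have hy : y - s (E.proj y) ∈ E.inc.range := by
        rw [E.exact, AddMonoidHom.mem_ker, map_sub, hs, sub_self]
      obtain ⟨z, hz⟩ := hy
      exact ⟨(z, E.proj y), by simp [φ, hz]⟩
  refine ⟨(AddEquiv.ofBijective φ hφ).symm, fun z => ?_, fun y => ?_⟩
  · refine (AddEquiv.symm_apply_eq (AddEquiv.ofBijective φ hφ)).mpr ?_
    change E.inc z = φ (z, 0)
    simp [φ]
  · obtain ⟨w, rfl⟩ := (AddEquiv.ofBijective φ hφ).surjective y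
    exact (congrArg Prod.snd ((AddEquiv.ofBijective φ hφ).symm_apply_apply w)).trans (hφp w).symm

end Cotorsion

/-! ### Ulm subgroups and division chains. -/

section Ulm

/-- A chain of successive divisions by `1, 2, 3, …` lies in every Ulm subgroup. -/
theorem mem_ulmSubgroup_of_chain {A : Type u} [AddCommGroup A] {x : ℕ → A}
    (hx : ∀ n, x n = (n + 1) • x (n + 1)) (o : Ordinal.{u}) (n : ℕ) : x n ∈ ulmSubgroup A o := by
  have hchain (n m : ℕ) : x n = (n + 1).ascFactorial m • x (n + m) := by
    induction m with
    | zero => simp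
    | succ m ih =>
      rw [ih, hx (n + m), smul_smul, Nat.ascFactorial_succ, mul_comm,
        show n + 1 + m = n + m + 1 by omega]
      rfl
  induction o using Ordinal.limitRecOn generalizing n with
  | zero => simp [ulmSubgroup]
  | add_one o ih =>
    simp only [ulmSubgroup_add_one, AddSubgroup.mem_iInf]
    intro m hm
    -- A product of `m` consecutive integers is divisible by `m`.
    obtain ⟨t, ht⟩ : m ∣ (n + 1).ascFactorial m :=
      (Nat.dvd_factorial hm le_rfl).trans (Nat.factorial_dvd_ascFactorial _ _)
    refine ⟨t • x (n + m), AddSubgroup.nsmul_mem _ (ih _) _, ?_⟩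
    rw [nsmulAddMonoidHom_apply, smul_smul, ← ht, ← hchain]
  | limit o ho ih =>
    simp only [ulmSubgroup_limit A o ho, AddSubgroup.mem_iInf]
    exact fun l hl => ih l hl n

theorem ulmLength_le_of_exists_chain {A : Type u} [AddCommGroup A] {o : Ordinal.{u}}
    (h : ∀ a ∈ ulmSubgroup A o, ∃ x : ℕ → A, x 0 = a ∧ ∀ n, x n = (n + 1) • x (n + 1)) :
    ulmLength A ≤ o := by
  refine csInf_le' (le_antisymm (ulmSubgroup_add_one_le A o) fun a ha => ?_)
  obtain ⟨x, rfl, hx⟩ := h a ha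
  exact mem_ulmSubgroup_of_chain hx _ 0

theorem exists_nsmul_eq_of_mem_ulmSubgroup_add_one {A : Type u} [AddCommGroup A] {o : Ordinal.{u}}
    {a : A} (ha : a ∈ ulmSubgroup A (o + 1)) (n : ℕ) :
    ∃ y ∈ ulmSubgroup A o, (n + 1) • y = a := by
  simp only [ulmSubgroup_add_one, AddSubgroup.mem_iInf] at ha
  exact ha (n + 1) (Nat.le_add_left 1 n)

end Ulm

/-! ### Quotients of countable products modulo finite supports. -/

section ReducedProduct

variable {C : ℕ → Type v} [∀ m, Group (C m)] {K : Type u} [CommGroup K]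

/-- A commutative quotient of a countable product that kills the finitely supported elements is
cotorsion. -/
theorem isCotorsion_of_eventually_one (π : (∀ m, C m) →* K) (hπ : Function.Surjective π)
    (hfin : ∀ f : ∀ m, C m, (∀ᶠ m in atTop, f m = 1) → π f = 1) : IsCotorsion (Additive K) := by
  refine isCotorsion_of_exists_solution fun a => ?_
  choose α hα using fun n => hπ (a n).toMul
  -- Truncation keeps the class and leaves coordinate `m` only the equations `n ≤ m`, solved
  -- downwards from the value `1`.
  let β : ℕ → ∀ m, C m := fun n m => if n ≤ m then α n m else 1
  have hβ (n : ℕ) : π (β n) = π (α n) := by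
    rw [← div_eq_one, ← map_div]
    refine hfin _ ?_
    filter_upwards [eventually_ge_atTop n] with m hm
    simp [β, hm]
  -- `y m d` is the coordinate `m` of the solution at the index `m + 1 - d`
  let y : ∀ m, ℕ → C m := fun m d =>
    Nat.rec 1 (fun d z => β (m - d) m * z ^ (m - d + 1)) d
  let x : ℕ → ∀ m, C m := fun n m => y m (m + 1 - n)
  have hx (n : ℕ) : x n = β n * x (n + 1) ^ (n + 1) := by
    funext m
    simp only [x, Pi.mul_apply, Pi.pow_apply]
    rcases le_or_gt n m with h | h
    · rw [show m + 1 - n = (m - n) + 1 by omega, show m + 1 - (n + 1) = m - n by omega]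
      simp only [y]
      rw [show m - (m - n) = n by omega]
    · rw [show m + 1 - n = 0 by omega, show m + 1 - (n + 1) = 0 by omega]
      simp [y, β, Nat.not_le.mpr h]
  refine ⟨fun n => Additive.ofMul (π (x n)), fun n => ?_⟩
  beta_reduce
  rw [hx n, map_mul, hβ, hα, map_pow, ofMul_mul, ofMul_pow]
  rfl

/-- Diagonalization in a countable product modulo finite supports: if every finite part of a
countable system of conditions on consecutive terms has a solution starting with `f`, then so does
the whole system. -/
theorem exists_eventually_of_forall_lt {C : ℕ → Type v} (R : ℕ → ∀ m, C m → C m → Prop)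
    (f : ∀ m, C m)
    (h : ∀ j, ∃ y : ℕ → ∀ m, C m, y 0 = f ∧ ∀ i < j, ∀ᶠ m in atTop, R i m (y i m) (y (i + 1) m)) :
    ∃ y : ℕ → ∀ m, C m, y 0 = f ∧ ∀ i, ∀ᶠ m in atTop, R i m (y i m) (y (i + 1) m) := by
  choose y hy0 hy using h
  have hN (j : ℕ) : ∃ N, ∀ m ≥ N, ∀ i < j, R i m (y j i m) (y j (i + 1) m) := by
    have : ∀ᶠ m in atTop, ∀ i ∈ Set.Iio j, R i m (y j i m) (y j (i + 1) m) :=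
      (eventually_all_finite (Set.finite_Iio j)).mpr (hy j)
    exact eventually_atTop.mp this
  choose N hN using hN
  -- Coordinate `m` uses the longest partial solution already valid there; the cap `m` makes the
  -- maximum exist, and `J` tends to infinity.
  let J : ℕ → ℕ := fun m => Nat.findGreatest (fun j => N j ≤ m) m
  refine ⟨fun i m => y (J m) i m, funext fun m => congrFun (hy0 (J m)) m, fun i => ?_⟩
  filter_upwards [eventually_ge_atTop (i + 1), eventually_ge_atTop (N (i + 1))] with m hm hm'
  exact hN (J m) m (Nat.findGreatest_spec (P := fun j => N j ≤ m) hm hm') i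
    (Nat.le_findGreatest (P := fun j => N j ≤ m) hm hm')

/-- If each partial choice of length `j` satisfying `P j` extends by one term, then there is an
infinite sequence all of whose initial segments satisfy `P`. -/
theorem exists_forall_of_exists_update (P : ℕ → (ℕ → ℕ) → Prop)
    (hcongr : ∀ j k k', (∀ i < j, k i = k' i) → P j k → P j k') (h0 : ∀ k, P 0 k)
    (hstep : ∀ j k, P j k → ∃ c, P (j + 1) (Function.update k j c)) : ∃ k, ∀ j, P j k := by
  choose c hc using hstep
  let s : ∀ j, {k // P j k} := fun j =>
    Nat.rec ⟨0, h0 0⟩ (fun j k => ⟨Function.update k.1 j (c j k.1 k.2), hc j k.1 k.2⟩) j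
  have hs (i d : ℕ) : (s (i + 1 + d)).1 i = (s (i + 1)).1 i := by
    induction d with
    | zero => rfl
    | succ d ih =>
      rw [← ih]
      have hne : i ≠ i + 1 + d := by omega
      exact Function.update_of_ne hne _ _
  refine ⟨fun i => (s (i + 1)).1 i, fun j => hcongr j _ _ (fun i hi => ?_) (s j).2⟩
  obtain ⟨d, rfl⟩ := Nat.exists_eq_add_of_le (Nat.succ_le_of_lt hi)
  exact hs i d

/-- If membership in the kernel of a commutative quotient of a countable product is decided by
countably many coordinatewise conditions up to finitely many coordinates, then the quotient has Ulm
length at most `ω₁`. -/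
theorem ulmLength_le_omega_one (π : (∀ m, C m) →* K) (hπ : Function.Surjective π)
    (S : ℕ → ∀ m, Set (C m))
    (hS : ∀ f : ∀ m, C m, π f = 1 ↔ ∃ k, ∀ᶠ m in atTop, f m ∈ S k m) :
    ulmLength (Additive K) ≤ Ordinal.omega 1 := by
  refine ulmLength_le_of_exists_chain fun a ha => ?_
  obtain ⟨f, hf⟩ := hπ a.toMul
  let R : ℕ → ℕ → ∀ m, C m → C m → Prop := fun k i m u w => u / w ^ (i + 1) ∈ S k m
  have hR (i : ℕ) (u w : ∀ m, C m) :
      π u = π w ^ (i + 1) ↔ ∃ k, ∀ᶠ m in atTop, R k i m (u m) (w m) := by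
    rw [← div_eq_one, ← map_pow, ← map_div, hS]
    rfl
  let Q : Ordinal.{u} → ℕ → (ℕ → ℕ) → Prop := fun o j k => ∃ y : ℕ → ∀ m, C m, y 0 = f ∧
    (∀ i < j, ∀ᶠ m in atTop, R (k i) i m (y i m) (y (i + 1) m)) ∧
    Additive.ofMul (π (y j)) ∈ ulmSubgroup (Additive K) o
  have hQ : ∃ k, ∀ j, ∀ o < Ordinal.omega 1, Q o j k := by
    refine exists_forall_of_exists_update (fun j k => ∀ o < Ordinal.omega 1, Q o j k) ?_ ?_ ?_
    · intro j k k' hk h o ho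
      obtain ⟨y, hy0, hy, hyo⟩ := h o ho
      exact ⟨y, hy0, fun i hi => hk i hi ▸ hy i hi, hyo⟩
    · intro k o ho
      refine ⟨fun _ => f, rfl, fun i hi => absurd hi (Nat.not_lt_zero i), ?_⟩
      rw [hf]
      exact ulmSubgroup_antitone _ ho.le ha
    · intro j k h
      -- Otherwise each candidate bound `c` fails at some `l c < ω₁`. Dividing once from level `(⨆
      -- c, l c) + 1` produces a bound that works at every `l c`.
      by_contra! hcon
      choose l hl hlQ using hcon
      have hsup : (⨆ c, l c) < Ordinal.omega 1 := Ordinal.iSup_lt_omega_one hl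
      obtain ⟨y, hy0, hy, hyo⟩ := h ((⨆ c, l c) + 1)
        ((Cardinal.isSuccLimit_omega 1).add_one_lt hsup)
      obtain ⟨z, hz, hzy⟩ := exists_nsmul_eq_of_mem_ulmSubgroup_add_one hyo j
      obtain ⟨w, hw⟩ := hπ z.toMul
      obtain ⟨c, hc⟩ := (hR j (y j) w).mp (by rw [hw]; exact hzy.symm)
      refine hlQ c ⟨Function.update y (j + 1) w, ?_, fun i hi => ?_, ?_⟩
      · rw [Function.update_of_ne (by omega), hy0]
      · have hne : i ≠ j + 1 := by omega
        rw [Function.update_of_ne hne w y]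
        rcases (Nat.lt_succ_iff_lt_or_eq.mp hi) with hi | rfl
        · have hne' : i + 1 ≠ j + 1 := by omega
          rw [Function.update_of_ne hi.ne c k, Function.update_of_ne hne' w y]
          exact hy i hi
        · rw [Function.update_self, Function.update_self]
          exact hc
      · rw [Function.update_self, hw]
        exact ulmSubgroup_antitone _ (Ordinal.le_iSup l c) hz
  obtain ⟨k, hk⟩ := hQ
  -- With the bounds fixed, the Ulm levels are no longer needed, so `o = 0` suffices.
  obtain ⟨y, hy0, hy⟩ := exists_eventually_of_forall_lt (fun i => R (k i) i) f fun j => by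
    obtain ⟨y, hy0, hy, -⟩ := hk j 0 (Ordinal.omega_pos 1)
    exact ⟨y, hy0, hy⟩
  refine ⟨fun n => Additive.ofMul (π (y n)), by beta_reduce; rw [hy0, hf]; rfl, fun n => ?_⟩
  beta_reduce
  rw [(hR n (y n) (y (n + 1))).mpr ⟨k n, hy n⟩, ofMul_pow]

end ReducedProduct

/-! ### Commutator length in products. -/

section Commutator

open scoped Pointwise

theorem one_mem_commutatorSet_pow (G : Type u) [Group G] (k : ℕ) : (1 : G) ∈ commutatorSet G ^ k :=
  Set.one_mem_pow (one_mem_commutatorSet G)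

theorem commutatorSet_pow_subset_commutator (G : Type u) [Group G] (k : ℕ) :
    commutatorSet G ^ k ⊆ (commutator G : Set G) := by
  rw [commutator_eq_closure]
  induction k with
  | zero => simp
  | succ k ih =>
    rw [pow_succ]
    rintro _ ⟨a, ha, b, hb, rfl⟩
    exact mul_mem (ih ha) (Subgroup.subset_closure hb)

/-- The commutator subgroup consists of the finite products of commutators. -/
theorem mem_commutator_iff_exists_pow {G : Type u} [Group G] {g : G} :
    g ∈ commutator G ↔ ∃ k, g ∈ commutatorSet G ^ k := by
  refine ⟨fun hg => ?_, fun ⟨k, hk⟩ => commutatorSet_pow_subset_commutator G k hk⟩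
  rw [commutator_eq_closure] at hg
  induction hg using Subgroup.closure_induction with
  | mem x hx => exact ⟨1, by simpa using hx⟩
  | one => exact ⟨0, by simp⟩
  | mul x y _ _ hx hy =>
    obtain ⟨k, hk⟩ := hx
    obtain ⟨l, hl⟩ := hy
    exact ⟨k + l, pow_add (commutatorSet G) k l ▸ Set.mul_mem_mul hk hl⟩
  | inv x _ hx =>
    obtain ⟨k, hk⟩ := hx
    have hinv : (commutatorSet G)⁻¹ = commutatorSet G := by
      ext z
      rw [Set.mem_inv]
      constructor
      · rintro ⟨a, b, h⟩
        exact ⟨b, a, by rw [← commutatorElement_inv, h, inv_inv]⟩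
      · rintro ⟨a, b, rfl⟩
        exact ⟨b, a, (commutatorElement_inv a b).symm⟩
    refine ⟨k, ?_⟩
    rw [← hinv, inv_pow]
    exact Set.inv_mem_inv.mpr hk

theorem mem_commutatorSet_pi {H : ℕ → Type u} [∀ n, Group (H n)] {f : ∀ n, H n} :
    f ∈ commutatorSet (∀ n, H n) ↔ ∀ n, f n ∈ commutatorSet (H n) := by
  constructor
  · rintro ⟨a, b, rfl⟩ n
    exact ⟨a n, b n, rfl⟩
  · intro h
    choose a b hab using h
    exact ⟨a, b, funext hab⟩

theorem mem_commutatorSet_pow_pi {H : ℕ → Type u} [∀ n, Group (H n)] {k : ℕ} {f : ∀ n, H n} :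
    f ∈ commutatorSet (∀ n, H n) ^ k ↔ ∀ n, f n ∈ commutatorSet (H n) ^ k := by
  induction k generalizing f with
  | zero => simp [funext_iff]
  | succ k ih =>
    simp only [pow_succ, Set.mem_mul]
    constructor
    · rintro ⟨a, ha, b, hb, rfl⟩ n
      exact ⟨a n, ih.mp ha n, b n, mem_commutatorSet_pi.mp hb n, rfl⟩
    · intro h
      choose a ha b hb hab using h
      exact ⟨a, ih.mpr ha, b, mem_commutatorSet_pi.mpr hb, funext hab⟩

/-- An element of `∏ C(Hₙ)` lies in `C(∏ Hₙ)` if and only if its coordinates are eventually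
products of a bounded number of commutators. -/
theorem mem_commutator_pi_iff_eventually {H : ℕ → Type u} [∀ n, Group (H n)] {f : ∀ n, H n}
    (hf : ∀ n, f n ∈ commutator (H n)) :
    f ∈ commutator (∀ n, H n) ↔ ∃ k, ∀ᶠ n in atTop, f n ∈ commutatorSet (H n) ^ k := by
  simp only [mem_commutator_iff_exists_pow, mem_commutatorSet_pow_pi] at hf ⊢
  constructor
  · rintro ⟨k, hk⟩
    exact ⟨k, Eventually.of_forall hk⟩
  · rintro ⟨k, hk⟩
    obtain ⟨N, hN⟩ := eventually_atTop.mp hk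
    choose c hc using hf
    -- `k` bounds the tail and the sum bounds the finitely many remaining lengths.
    refine ⟨k + ∑ i ∈ Finset.range N, c i, fun n => ?_⟩
    have hmono {p q : ℕ} (hpq : p ≤ q) : commutatorSet (H n) ^ p ⊆ commutatorSet (H n) ^ q :=
      Set.pow_subset_pow_right (one_mem_commutatorSet (H n)) hpq
    rcases le_or_gt N n with h | h
    · exact hmono (Nat.le_add_right _ _) (hN n h)
    · exact hmono (le_add_left (Finset.single_le_sum (fun i _ => Nat.zero_le (c i))
        (Finset.mem_range.mpr h))) (hc n)

end Commutator

/-! ### The kernel of `ρ` as a quotient of `∏ C(Hₙ)`. -/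

section AbProdMap

variable (H : ℕ → Type u) [∀ n, Group (H n)]

theorem abelianization_of_eq_one_iff {G : Type u} [Group G] {g : G} :
    Abelianization.of g = 1 ↔ g ∈ commutator G :=
  QuotientGroup.eq_one_iff g

theorem abProdMap_of (f : ∀ n, H n) :
    abProdMap H (Abelianization.of f) = fun n => Abelianization.of (f n) :=
  rfl

theorem abProdMap_surjective : Function.Surjective (abProdMap H) := by
  intro y
  choose f hf using fun n => QuotientGroup.mk_surjective (y n)
  exact ⟨Abelianization.of f, funext hf⟩

theorem mem_prodCommutator {f : ∀ n, H n} :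
    f ∈ prodCommutator H ↔ ∀ n, f n ∈ commutator (H n) := by
  simp [prodCommutator, Subgroup.mem_pi]

theorem of_mem_ker_abProdMap {f : ∀ n, H n} :
    Abelianization.of f ∈ (abProdMap H).ker ↔ f ∈ prodCommutator H := by
  rw [MonoidHom.mem_ker, abProdMap_of, mem_prodCommutator, funext_iff]
  exact forall_congr' fun n => abelianization_of_eq_one_iff

theorem commutator_pi_le_prodCommutator : commutator (∀ n, H n) ≤ prodCommutator H := by
  intro f hf
  rw [← of_mem_ker_abProdMap, abelianization_of_eq_one_iff.mpr hf]
  exact one_mem _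

/-- The restriction of `∏ Hₙ → Ab (∏ Hₙ)` to a map from `∏ C(Hₙ)` to the kernel of `abProdMap`. -/
def prodCommutatorToKer : prodCommutator H →* (abProdMap H).ker :=
  (Abelianization.of.comp (prodCommutator H).subtype).codRestrict _
    fun x => (of_mem_ker_abProdMap H).mpr x.2

theorem prodCommutatorToKer_surjective : Function.Surjective (prodCommutatorToKer H) := by
  rintro ⟨y, hy⟩
  obtain ⟨f, rfl⟩ := QuotientGroup.mk_surjective y
  exact ⟨⟨f, (of_mem_ker_abProdMap H).mp hy⟩, rfl⟩

theorem prodCommutatorToKer_eq_one_iff (x : prodCommutator H) :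
    prodCommutatorToKer H x = 1 ↔ (x : ∀ n, H n) ∈ commutator (∀ n, H n) := by
  rw [← abelianization_of_eq_one_iff, Subtype.ext_iff]
  rfl

theorem ker_prodCommutatorToKer :
    (prodCommutatorToKer H).ker = (commutator (∀ n, H n)).subgroupOf (prodCommutator H) := by
  ext x
  rw [MonoidHom.mem_ker, prodCommutatorToKer_eq_one_iff, Subgroup.mem_subgroupOf]

/-- The group of families of elements of the `C(Hₙ)` maps to `∏ C(Hₙ)` seen inside `∏ Hₙ`. -/
def piCommutatorToProd : (∀ n, commutator (H n)) →* prodCommutator H where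
  toFun f := ⟨fun n => f n, (mem_prodCommutator H).mpr fun n => (f n).2⟩
  map_one' := rfl
  map_mul' _ _ := rfl

theorem piCommutatorToProd_surjective : Function.Surjective (piCommutatorToProd H) :=
  fun x => ⟨fun n => ⟨x.1 n, (mem_prodCommutator H).mp x.2 n⟩, rfl⟩

end AbProdMap

-- This provides the condition `hS` of `ulmLength_le_omega_one`, with `∏ C(Hₙ)` as a product of
-- groups.
open scoped Pointwise in
theorem prodCommutatorToKer_piCommutatorToProd_eq_one_iff (H : ℕ → Type u) [∀ n, Group (H n)]
    (f : ∀ n, commutator (H n)) :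
    prodCommutatorToKer H (piCommutatorToProd H f) = 1 ↔
      ∃ k, ∀ᶠ n in atTop, f n ∈ {c : commutator (H n) | (c : H n) ∈ commutatorSet (H n) ^ k} :=
  (prodCommutatorToKer_eq_one_iff H _).trans (mem_commutator_pi_iff_eventually fun n => (f n).2)

theorem theoremt (H : ℕ → Type u) [∀ n, Group (H n)] :
    Function.Surjective (abProdMap H) ∧
    commutator (∀ n, H n) ≤ prodCommutator H ∧
    (∃ e : (prodCommutator H ⧸ (commutator (∀ n, H n)).subgroupOf (prodCommutator H)) ≃*
        (abProdMap H).ker,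
      ∀ x : prodCommutator H,
        (e (QuotientGroup.mk x) : Abelianization (∀ n, H n)) = Abelianization.of (x : ∀ n, H n)) ∧
    IsCotorsion (Additive (abProdMap H).ker) ∧
    ulmLength (Additive (abProdMap H).ker) ≤ Ordinal.omega 1 := by
  have hsurj : Function.Surjective ((prodCommutatorToKer H).comp (piCommutatorToProd H)) :=
    (prodCommutatorToKer_surjective H).comp (piCommutatorToProd_surjective H)
  refine ⟨abProdMap_surjective H, commutator_pi_le_prodCommutator H,
    ⟨(QuotientGroup.quotientMulEquivOfEq (ker_prodCommutatorToKer H).symm).trans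
      (QuotientGroup.quotientKerEquivOfSurjective _ (prodCommutatorToKer_surjective H)),
      fun x => rfl⟩,
    isCotorsion_of_eventually_one _ hsurj fun f hf => ?_,
    ulmLength_le_omega_one _ hsurj _ (prodCommutatorToKer_piCommutatorToProd_eq_one_iff H)⟩
  refine (prodCommutatorToKer_piCommutatorToProd_eq_one_iff H f).mpr ⟨0, hf.mono fun n hn => ?_⟩
  rw [hn]
  exact one_mem_commutatorSet_pow (H n) 0
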